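/- For positive integers $l_1,\dots,l_m$ with $l_1\ge 2$, let $$\zeta(l_1,\dots,l_m)=\sum_{n_1>\cdots>n_m\ge 1}\frac{1}{n_1^{l_1}\cdots n_m^{l_m}}$$ be the multiple zeta value. An index is a finite tuple of positive integers; its depth $\operatorname{dep}$ is the number of its entries and its weight $\operatorname{wt}$ is their sum. For two indices of the same depth, $\mathbf k+\mathbf r$ is the entrywise sum. An index $\mathbf k'$ refines $\mathbf k$, written $\mathbf k'\succeq\mathbf k$, if $\mathbf k$ can be obtained from $\mathbf k'$ by combining some of its adjacent parts (replacing blocks of adjacent parts by their sums; $\mathbf k\succeq\mathbf k$). Write $\{1\}^{m}$ for a string of $m$ ones. **Theorem.** Let $d\ge 1$, let $\mathbf k=(k_1,\dots,k_d)$ be an index of depth $d$, and let $r\ge d$ be an integer. Then all the multiple zeta series below converge, and $$\sum_{\substack{r_1+\cdots+r_d=r\\ r_i\ge 1\ (1\le i\le d)}}\zeta\bigl(k_1+1,\{1\}^{r_1-1},\dots,k_d+1,\{1\}^{r_d-1}\bigr)=\sum_{\substack{\mathbf k'\succeq\mathbf k\\ \operatorname{dep}(\mathbf k')\le r}}\ \sum_{\substack{\operatorname{wt}(\mathbf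 r)=r\\ \operatorname{dep}(\mathbf r)=\operatorname{dep}(\mathbf k')}}(-1)^{\operatorname{dep}(\mathbf k')-d}\,\zeta(\mathbf k'+\mathbf r),$$ where $\mathbf k'$ and $\mathbf r$ run over indices. -/

import Mathlib

/-- The summation range of a multiple zeta value of depth `d`:
tuples of integers `n_1 > n_2 > ⋯ > n_d ≥ 1`. -/
def DecreasingTuple (d : ℕ) : Type :=
  {n : Fin d → ℕ // StrictAnti n ∧ ∀ i, 1 ≤ n i}

/-- The summand `1 / (n_1 ^ k_1 ⋯ n_d ^ k_d)` for the index `k = (k_1, …, k_d)`. -/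
noncomputable def mzvTerm (k : List ℕ) (n : DecreasingTuple k.length) : ℝ :=
  1 / ∏ i : Fin k.length, (n.1 i : ℝ) ^ (k.get i)

/-- The series defining `ζ(k_1, …, k_d)` converges. (The terms are nonnegative, so convergence and
unconditional convergence are the same thing.) -/
def MZVConverges (k : List ℕ) : Prop :=
  Summable (mzvTerm k)

/-- The multiple zeta value `ζ(k_1, …, k_d) = ∑_{n_1 > ⋯ > n_d ≥ 1} 1 / (n_1 ^ k_1 ⋯ n_d ^ k_d)`. -/
noncomputable def mzv (k : List ℕ) : ℝ :=
  ∑' n : DecreasingTuple k.length, mzvTerm k n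

/-- `k'` refines `k`: the index `k` is obtained from `k'` by cutting `k'` into nonempty blocks of
adjacent parts and adding up the parts of each block. -/
def Refines (k' k : List ℕ) : Prop :=
  ∃ B : List (List ℕ), (∀ b ∈ B, b ≠ []) ∧ B.flatten = k' ∧ B.map List.sum = k

/-- The componentwise sum `k + r` of two indices of the same depth. -/
def indexAdd (k r : List ℕ) : List ℕ :=
  List.zipWith (fun a b => a + b) k r

/-- The index `(k_1 + 1, 1, …, 1, …, k_d + 1, 1, …, 1)`, in which `k_i + 1` is followed by
`r_i - 1` ones (all `r_i ≥ 1`). -/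
def insertOnes (k r : List ℕ) : List ℕ :=
  (List.zipWith (fun a b => (a + 1) :: List.replicate (b - 1) 1) k r).flatten

/-! Both sides are compared through power series in X whose exponent records the weight r. On the
right, the sum over s ≥ 1 of X^s / n^(a+s) is X / (n^a (n - X)), so the signed sum over refinements
becomes a combination of nested sums of such factors (`refineGen`). On the left, the ones inserted
between n_i and n_(i+1) contribute the product of 1 + X/j over n_(i+1) < j < n_i. Together these
give the product of 1 + X/j over j ≤ n_1, times the factors X / (n_i^(k_i) (n_i + X))
(`insertGen_eq`, `addSeq`).

The two sides are linked by a finite identity: the partial sum of `refineGen k` over n ≤ m equals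
the sum over n ≤ m of `kernel m n * addSeq k n` (`kernelRelated_refineGen`). An index is built from
the empty one by prepending 1 and by adding 1 to its head. Two difference equations for the kernel
show that both moves preserve the identity (`KernelRelated.cons_one`, `KernelRelated.succ_head`).

Finally m tends to infinity. The kernel is the product of 1 + X/j over j ≤ n, times a product of n
factors 1 / (1 - X/j) with j near m, which tends to 1 coefficientwise. Bounds by powers of harmonic
numbers justify exchanging limit and sum (`tendsto_sum_kernel`). -/

/-! ### The kernel and its difference equations. -/

/-- The power series `1 / (y - X) = ∑ X ^ j / y ^ (j + 1)`. -/
noncomputable def geomInv (y : ℝ) : PowerSeries ℝ :=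
  PowerSeries.mk fun j => y⁻¹ ^ (j + 1)

theorem sub_X_mul_geomInv {y : ℝ} (hy : y ≠ 0) :
    (PowerSeries.C y - PowerSeries.X) * geomInv y = 1 := by
  ext n
  rw [sub_mul, map_sub, PowerSeries.coeff_C_mul]
  cases n with
  | zero => simp [geomInv, hy]
  | succ n =>
    rw [PowerSeries.coeff_succ_X_mul]
    simp only [geomInv, PowerSeries.coeff_mk, PowerSeries.coeff_one]
    simp only [Nat.succ_ne_zero, if_false]
    rw [pow_succ' _ (n + 1), ← mul_assoc, mul_inv_cancel₀ hy, one_mul, sub_self]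

/-- Multiplication by `1 / n` on power series. -/
noncomputable def invC (n : ℕ) : PowerSeries ℝ := PowerSeries.C ((n : ℝ)⁻¹)

theorem natCast_mul_invC {n : ℕ} (hn : n ≠ 0) : (n : PowerSeries ℝ) * invC n = 1 := by
  have : (n : PowerSeries ℝ) = PowerSeries.C (n : ℝ) := by simp
  rw [this, invC, ← map_mul, mul_inv_cancel₀ (by exact_mod_cast hn), map_one]

theorem natCast_sub_X_mul {n : ℕ} (hn : n ≠ 0) :
    ((n : PowerSeries ℝ) - PowerSeries.X) * geomInv n = 1 := by
  have := sub_X_mul_geomInv (y := n) (by exact_mod_cast hn)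
  simpa using this

/-- The power series `1 / (n + X)`. -/
noncomputable def addInv (n : ℕ) : PowerSeries ℝ := -geomInv (-(n : ℝ))

theorem natCast_add_X_mul {n : ℕ} (hn : n ≠ 0) :
    ((n : PowerSeries ℝ) + PowerSeries.X) * addInv n = 1 := by
  have := sub_X_mul_geomInv (y := -(n : ℝ)) (by simpa using hn)
  rw [← this, addInv]
  simp only [map_neg, map_natCast]
  ring

/-- `∏_{1 ≤ j ≤ n} (j + X)`. -/
noncomputable def risePoch (n : ℕ) : PowerSeries ℝ :=
  ∏ j ∈ Finset.range n, (((j + 1 : ℕ) : PowerSeries ℝ) + PowerSeries.X)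

/-- `∏_{1 ≤ j ≤ n} (j - X)`. -/
noncomputable def fallPoch (n : ℕ) : PowerSeries ℝ :=
  ∏ j ∈ Finset.range n, (((j + 1 : ℕ) : PowerSeries ℝ) - PowerSeries.X)

/-- `∏_{1 ≤ j ≤ n} 1 / (j - X)`. -/
noncomputable def fallPochInv (n : ℕ) : PowerSeries ℝ :=
  ∏ j ∈ Finset.range n, geomInv ((j + 1 : ℕ) : ℝ)

theorem fallPoch_mul_inv (n : ℕ) : fallPoch n * fallPochInv n = 1 := by
  rw [fallPoch, fallPochInv, ← Finset.prod_mul_distrib]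
  exact Finset.prod_eq_one fun j _ => natCast_sub_X_mul (Nat.succ_ne_zero j)

theorem fallPoch_ne_zero (n : ℕ) : fallPoch n ≠ 0 :=
  left_ne_zero_of_mul_eq_one (fallPoch_mul_inv n)

theorem risePoch_succ (n : ℕ) :
    risePoch (n + 1) = risePoch n * (((n + 1 : ℕ) : PowerSeries ℝ) + PowerSeries.X) :=
  Finset.prod_range_succ _ _

theorem fallPoch_succ (n : ℕ) :
    fallPoch (n + 1) = fallPoch n * (((n + 1 : ℕ) : PowerSeries ℝ) - PowerSeries.X) :=
  Finset.prod_range_succ _ _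

/-- The kernel `binom m n * (1 + X)_n * (1 - X)_{m - n} / (1 - X)_m`. -/
noncomputable def kernel (m n : ℕ) : PowerSeries ℝ :=
  (m.choose n : PowerSeries ℝ) * risePoch n * fallPoch (m - n) * fallPochInv m

theorem kernel_mul (m n : ℕ) :
    kernel m n * fallPoch m = (m.choose n : PowerSeries ℝ) * risePoch n * fallPoch (m - n) := by
  rw [kernel, mul_assoc, mul_comm (fallPochInv m), fallPoch_mul_inv, mul_one]

theorem kernel_zero_right (m : ℕ) : kernel m 0 = 1 := by
  simp [kernel, risePoch, fallPoch_mul_inv]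

theorem kernel_of_lt {m n : ℕ} (h : m < n) : kernel m n = 0 := by
  simp [kernel, Nat.choose_eq_zero_of_lt h]

/-- For n ≤ m the ratio of the two kernels is (m+1)(m+1-n-X) / ((m+1-n)(m+1-X)); subtracting 1
leaves -nX in the numerator. With denominators cleared the identity also covers n > m. -/
theorem kernel_succ_sub_kernel (m n : ℕ) :
    ((n : PowerSeries ℝ) - ((m + 1 : ℕ) : PowerSeries ℝ)) *
      (((m + 1 : ℕ) : PowerSeries ℝ) - PowerSeries.X) *
      (kernel (m + 1) n - kernel m n) = (n : PowerSeries ℝ) * PowerSeries.X * kernel m n := by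
  rcases lt_trichotomy n (m + 1) with h | h | h
  · obtain ⟨q, rfl⟩ := Nat.exists_eq_add_of_le (Nat.le_of_lt_succ h)
    apply mul_right_cancel₀ (fallPoch_ne_zero (n + q))
    have h1 := kernel_mul (n + q + 1) n
    have h2 := kernel_mul (n + q) n
    have e : n + q + 1 - n = q + 1 := by omega
    rw [e, fallPoch_succ, fallPoch_succ] at h1
    rw [Nat.add_sub_cancel_left] at h2
    have h3 : ((n + q + 1).choose n : PowerSeries ℝ) * (q + 1) =
        (n + q).choose n * (n + q + 1) := by
      have := Nat.choose_mul_succ_eq (n + q) n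
      rw [e] at this
      simpa using (congrArg (Nat.cast (R := PowerSeries ℝ)) this).symm
    push_cast at h1 h2 h3 ⊢
    linear_combination (-((q : PowerSeries ℝ) + 1)) * h1 +
      ((q + 1) * (n + q + 1 - PowerSeries.X) - n * PowerSeries.X) * h2 -
      risePoch n * fallPoch q * (q + 1 - PowerSeries.X) * h3
  · subst h
    rw [kernel_of_lt (Nat.lt_succ_self m)]; simp
  · rw [kernel_of_lt (by omega), kernel_of_lt (by omega)]; simp

/-- After multiplication by `fallPoch m`, this reduces to Pascal's rule and (n+1) binom(m, n+1) =
(m-n) binom(m, n). It trades a difference in m for a difference in n. -/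
theorem kernel_sub_kernel_succ (m n : ℕ) :
    ((m + 1 : ℕ) : PowerSeries ℝ) * (((m + 1 : ℕ) : PowerSeries ℝ) - PowerSeries.X) *
      (kernel (m + 1) (n + 1) - kernel m (n + 1)) =
    ((n + 1 : ℕ) : PowerSeries ℝ) * (((n + 1 : ℕ) : PowerSeries ℝ) + PowerSeries.X) *
      (kernel m n - kernel m (n + 1)) := by
  rcases lt_trichotomy n m with h | h | h
  · obtain ⟨q, rfl⟩ := Nat.exists_eq_add_of_lt h
    apply mul_right_cancel₀ (fallPoch_ne_zero (n + q + 1))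
    have h1 := kernel_mul (n + q + 1 + 1) (n + 1)
    have h2 := kernel_mul (n + q + 1) (n + 1)
    have h3 := kernel_mul (n + q + 1) n
    have e1 : n + q + 1 + 1 - (n + 1) = q + 1 := by omega
    have e2 : n + q + 1 - (n + 1) = q := by omega
    have e3 : n + q + 1 - n = q + 1 := by omega
    rw [e1, fallPoch_succ (n + q + 1), fallPoch_succ q, risePoch_succ] at h1
    rw [e2, risePoch_succ] at h2
    rw [e3, fallPoch_succ q] at h3
    have h4 : ((n + q + 1 + 1).choose (n + 1) : PowerSeries ℝ) =
        (n + q + 1).choose n + (n + q + 1).choose (n + 1) := by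
      simpa using congrArg (Nat.cast (R := PowerSeries ℝ)) (Nat.choose_succ_succ (n + q + 1) n)
    have h5 : ((n + q + 1).choose (n + 1) : PowerSeries ℝ) * (n + 1) =
        (n + q + 1).choose n * (q + 1) := by
      have := Nat.choose_succ_right_eq (n + q + 1) n
      rw [e3] at this
      simpa using congrArg (Nat.cast (R := PowerSeries ℝ)) this
    rw [h4] at h1
    push_cast at h1 h2 h3 h5 ⊢
    set X : PowerSeries ℝ := PowerSeries.X
    set a : PowerSeries ℝ := ((n + q + 1).choose n : PowerSeries ℝ)
    set b : PowerSeries ℝ := ((n + q + 1).choose (n + 1) : PowerSeries ℝ)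
    have key : ((n : PowerSeries ℝ) + q + 1 + 1) *
        ((a + b) * (risePoch n * (n + 1 + X)) * (fallPoch q * (q + 1 - X)) -
          (n + q + 1 + 1 - X) * (b * (risePoch n * (n + 1 + X)) * fallPoch q)) =
        (n + 1) * (n + 1 + X) * (a * risePoch n * (fallPoch q * (q + 1 - X)) -
          b * (risePoch n * (n + 1 + X)) * fallPoch q) := by
      linear_combination (-risePoch n * fallPoch q * (n + 1 + X) * (q + 1 - X)) * h5
    linear_combination ((n : PowerSeries ℝ) + q + 1 + 1) * h1 -
      ((n + q + 1 + 1) * (n + q + 1 + 1 - X) - (n + 1) * (n + 1 + X)) * h2 -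
      (n + 1) * (n + 1 + X) * h3 + key
  · subst h
    apply mul_right_cancel₀ (fallPoch_ne_zero n)
    have h1 := kernel_mul (n + 1) (n + 1)
    have h3 := kernel_mul n n
    rw [fallPoch_succ, risePoch_succ, Nat.sub_self, Nat.choose_self] at h1
    rw [Nat.sub_self, Nat.choose_self] at h3
    rw [kernel_of_lt (Nat.lt_succ_self n)]
    push_cast at h1 h3 ⊢
    linear_combination ((n : PowerSeries ℝ) + 1) * h1 - (n + 1) * (n + 1 + PowerSeries.X) * h3
  · rw [kernel_of_lt (by omega), kernel_of_lt (by omega), kernel_of_lt (by omega)]; simp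

/-! ### Pairs of sequences related by the kernel. -/

/-- The partial sums `∑_{j < n} f j`. -/
noncomputable def partialSum {R : Type*} [AddCommMonoid R] (f : ℕ → R) (n : ℕ) : R :=
  ∑ j ∈ Finset.range n, f j

theorem partialSum_succ {R : Type*} [AddCommMonoid R] (f : ℕ → R) (n : ℕ) :
    partialSum f (n + 1) = partialSum f n + f n :=
  Finset.sum_range_succ f n

theorem partialSum_zero {R : Type*} [AddCommMonoid R] (f : ℕ → R) : partialSum f 0 = 0 := rfl

/-- The sequences `g` and `h` are related by the kernel. -/
def KernelRelated (g h : ℕ → PowerSeries ℝ) : Prop :=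
  ∀ m, partialSum g (m + 1) = ∑ n ∈ Finset.range (m + 1), kernel m n * h n

/-- Differencing in m gives the local form. The range may extend to n = m + 1 in both sums because
the kernel vanishes for n > m. -/
theorem kernelRelated_iff {g h : ℕ → PowerSeries ℝ} :
    KernelRelated g h ↔ g 0 = h 0 ∧ ∀ m, g (m + 1) =
      ∑ n ∈ Finset.range (m + 2), (kernel (m + 1) n - kernel m n) * h n := by
  have aux : ∀ m, ∑ n ∈ Finset.range (m + 2), (kernel (m + 1) n - kernel m n) * h n =
      ∑ n ∈ Finset.range (m + 2), kernel (m + 1) n * h n -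
        ∑ n ∈ Finset.range (m + 1), kernel m n * h n := by
    intro m
    simp only [sub_mul, Finset.sum_sub_distrib]
    rw [Finset.sum_range_succ (fun n => kernel m n * h n), kernel_of_lt (Nat.lt_succ_self m)]
    simp
  constructor
  · intro H
    refine ⟨?_, fun m => ?_⟩
    · simpa [partialSum, kernel_zero_right] using H 0
    · rw [aux, ← H m, ← H (m + 1), partialSum_succ g (m + 1)]
      ring
  · rintro ⟨h0, H⟩ m
    induction m with
    | zero => simpa [partialSum, kernel_zero_right] using h0
    | succ m ih =>
      rw [partialSum_succ, ih, H, aux]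
      ring

/-- The second difference equation converts 1 / (n (n + X)) into the factor 1 / ((m+1)(m+1-X)),
which leaves the sum. What remains is a difference in n, and summation by parts returns the
hypothesis. -/
theorem KernelRelated.cons_one {g h : ℕ → PowerSeries ℝ} (H : KernelRelated g h) :
    KernelRelated (fun n => PowerSeries.X * invC n * geomInv n * partialSum g n)
      (fun n => PowerSeries.X * invC n * addInv n * partialSum h n) := by
  refine kernelRelated_iff.2 ⟨by simp [partialSum_zero], fun m => ?_⟩
  have hm := natCast_mul_invC (Nat.succ_ne_zero m)
  have hm' := natCast_sub_X_mul (Nat.succ_ne_zero m)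
  have step : ∀ n, (kernel (m + 1) (n + 1) - kernel m (n + 1)) *
      (PowerSeries.X * invC (n + 1) * addInv (n + 1) * partialSum h (n + 1)) =
      PowerSeries.X * invC (m + 1) * geomInv ((m + 1 : ℕ) : ℝ) *
        ((kernel m n - kernel m (n + 1)) * partialSum h (n + 1)) := by
    intro n
    have hn := natCast_mul_invC (Nat.succ_ne_zero n)
    have hn' := natCast_add_X_mul (Nat.succ_ne_zero n)
    have hk := kernel_sub_kernel_succ m n
    simp only [Nat.succ_eq_add_one] at hm hm' hn hn'
    set X : PowerSeries ℝ := PowerSeries.X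
    set A : PowerSeries ℝ := ((m + 1 : ℕ) : PowerSeries ℝ)
    set B : PowerSeries ℝ := ((n + 1 : ℕ) : PowerSeries ℝ)
    have h1 : A * (A - X) * (invC (m + 1) * geomInv ((m + 1 : ℕ) : ℝ)) = 1 := by
      linear_combination (A - X) * geomInv ((m + 1 : ℕ) : ℝ) * hm + hm'
    have h2 : B * (B + X) * (invC (n + 1) * addInv (n + 1)) = 1 := by
      linear_combination (B + X) * addInv (n + 1) * hn + hn'
    set u := invC (m + 1) * geomInv ((m + 1 : ℕ) : ℝ)
    set v := invC (n + 1) * addInv (n + 1)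
    have h3 : (kernel (m + 1) (n + 1) - kernel m (n + 1)) * v =
        u * (kernel m n - kernel m (n + 1)) := by
      linear_combination u * v * hk - (kernel (m + 1) (n + 1) - kernel m (n + 1)) * v * h1 +
        u * (kernel m n - kernel m (n + 1)) * h2
    linear_combination X * partialSum h (n + 1) * h3
  -- Summation by parts; at N = m + 1 the boundary term vanishes with the kernel.
  have abel : ∀ N, ∑ n ∈ Finset.range N, (kernel m n - kernel m (n + 1)) * partialSum h (n + 1) =
      ∑ n ∈ Finset.range N, kernel m n * h n - kernel m N * partialSum h N := by
    intro N
    induction N with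
    | zero => simp [partialSum_zero]
    | succ N ih =>
      rw [Finset.sum_range_succ, ih, Finset.sum_range_succ, partialSum_succ]
      ring
  rw [Finset.sum_range_succ', Finset.sum_congr rfl fun n _ => step n, ← Finset.mul_sum, abel,
    H m, kernel_of_lt (Nat.lt_succ_self m)]
  simp [partialSum_zero]

/-- Dividing the first difference equation by n(m+1) expresses the change from 1/(m+1) to 1/n as a
multiple of the kernel itself, whose sum against h is a partial sum of g. -/
theorem KernelRelated.succ_head {g h : ℕ → PowerSeries ℝ} (H : KernelRelated g h) (h0 : h 0 = 0) :
    KernelRelated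
      (fun n => invC n * g n - PowerSeries.X * invC n * geomInv n * partialSum g n)
      (fun n => invC n * h n) := by
  have H' := kernelRelated_iff.1 H
  refine kernelRelated_iff.2 ⟨by simp [partialSum_zero, H'.1], fun m => ?_⟩
  have hs : partialSum g (m + 1) = ∑ n ∈ Finset.range (m + 2), kernel m n * h n := by
    rw [H m, Finset.sum_range_succ _ (m + 1), kernel_of_lt (Nat.lt_succ_self m)]
    simp
  rw [H'.2 m, hs, Finset.mul_sum, Finset.mul_sum, ← Finset.sum_sub_distrib]
  refine Finset.sum_congr rfl fun n _ => ?_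
  -- Since `invC 0 = 0` is not an inverse, the term n = 0 is removed by `h0`.
  rcases eq_or_ne n 0 with rfl | hn0
  · simp [h0]
  have hm := natCast_mul_invC (Nat.succ_ne_zero m)
  have hm' := natCast_sub_X_mul (Nat.succ_ne_zero m)
  have hn := natCast_mul_invC hn0
  have hk := kernel_succ_sub_kernel m n
  simp only [Nat.succ_eq_add_one] at hm hm' hn
  set X : PowerSeries ℝ := PowerSeries.X
  set A : PowerSeries ℝ := ((m + 1 : ℕ) : PowerSeries ℝ)
  set K := kernel (m + 1) n - kernel m n
  set u := geomInv ((m + 1 : ℕ) : ℝ)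
  set a := invC (m + 1)
  set b := invC n
  have h3 : ((n : PowerSeries ℝ) - A) * K = n * X * u * kernel m n := by
    linear_combination u * hk - (n - A) * K * hm'
  have h4 : K * a - X * a * u * kernel m n = K * b := by
    linear_combination a * b * h3 + (K * b) * hm + (X * u * a * kernel m n - K * a) * hn
  linear_combination h n * h4

/-- The empty index: unit mass at 0 plays the role of a final variable n_(d+1) = 0 below all others.
-/
theorem kernelRelated_single :
    KernelRelated (Pi.single 0 1) (Pi.single 0 1) := by
  intro m
  simp [partialSum, Finset.sum_range_succ', kernel_zero_right]

/-! ### Generating series over the added index. -/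

/-- The terms of the multiple zeta series with leading summation variable `n`. -/
noncomputable def mzvSeq : List ℕ → ℕ → ℝ
  | [] => Pi.single 0 1
  | a :: l => fun n => (n : ℝ)⁻¹ ^ a * partialSum (mzvSeq l) n

/-- The generating series of `mzvSeq (l + s)` over the weight of `s`. -/
noncomputable def genSeq : List ℕ → ℕ → PowerSeries ℝ
  | [] => Pi.single 0 1
  | a :: l => fun n => PowerSeries.X * invC n ^ a * geomInv n * partialSum (genSeq l) n

/-- The lists of `p` positive integers with sum `r`. -/
def posLists : ℕ → ℕ → Finset (List ℕ)
  | 0, 0 => {[]}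
  | 0, _ + 1 => ∅
  | _ + 1, 0 => ∅
  | p + 1, r + 1 => (Finset.HasAntidiagonal.antidiagonal r).biUnion fun ij =>
      (posLists p ij.2).image fun s => (ij.1 + 1) :: s

theorem mem_posLists {p r : ℕ} {s : List ℕ} :
    s ∈ posLists p r ↔ s.length = p ∧ s.sum = r ∧ ∀ a ∈ s, 1 ≤ a := by
  induction p generalizing r s with
  | zero =>
    cases r with
    | zero =>
      simp only [posLists, Finset.mem_singleton, List.length_eq_zero_iff]
      constructor
      · rintro rfl; simp
      · exact fun h => h.1
    | succ r =>
      simp only [posLists, Finset.notMem_empty, List.length_eq_zero_iff, false_iff]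
      rintro ⟨rfl, h, -⟩
      simp at h
  | succ p ih =>
    cases r with
    | zero =>
      simp only [posLists, Finset.notMem_empty, false_iff]
      rintro ⟨h1, h2, h3⟩
      cases s with
      | nil => simp at h1
      | cons a s =>
        have := h3 a (by simp)
        simp at h2
        omega
    | succ r =>
      simp only [posLists, Finset.mem_biUnion, Finset.HasAntidiagonal.mem_antidiagonal, Finset.mem_image, ih]
      constructor
      · rintro ⟨⟨i, j⟩, hij, s, ⟨h1, h2, h3⟩, rfl⟩
        simp only at *
        refine ⟨by simp [h1], by simp [h2]; omega, ?_⟩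
        simpa using h3
      · rintro ⟨h1, h2, h3⟩
        cases s with
        | nil => simp at h1
        | cons a s =>
          have ha := h3 a (by simp)
          simp only [List.length_cons, Nat.add_right_cancel_iff, List.sum_cons] at h1 h2
          refine ⟨(a - 1, s.sum), by simp only; omega, s,
            ⟨h1, rfl, fun b hb => h3 b (by simp [hb])⟩, ?_⟩
          simp only [List.cons.injEq, and_true]
          omega

theorem sum_posLists_succ {M : Type*} [AddCommMonoid M] (p r : ℕ) (f : List ℕ → M) :
    ∑ s ∈ posLists (p + 1) (r + 1), f s =
      ∑ ij ∈ Finset.HasAntidiagonal.antidiagonal r, ∑ s ∈ posLists p ij.2, f ((ij.1 + 1) :: s) := by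
  rw [posLists, Finset.sum_biUnion]
  · refine Finset.sum_congr rfl fun ij _ => ?_
    rw [Finset.sum_image]
    intro a _ b _ h
    simpa using h
  · intro x hx y hy hxy
    simp only [Function.onFun]
    rw [Finset.disjoint_left]
    rintro a ha hb
    simp only [Finset.mem_image] at ha hb
    obtain ⟨s, hs, rfl⟩ := ha
    obtain ⟨s', hs', h⟩ := hb
    simp only [List.cons.injEq, Nat.add_right_cancel_iff] at h
    simp only [Finset.mem_coe, Finset.HasAntidiagonal.mem_antidiagonal] at hx hy
    apply hxy
    ext
    · exact h.1.symm
    · omega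

theorem sum_composition_eq_sum_posLists {M : Type*} [AddCommMonoid M] (p r : ℕ)
    (f : List ℕ → M) :
    ∑ s : Composition r with s.length = p, f s.blocks = ∑ s ∈ posLists p r, f s := by
  refine Finset.sum_bij (fun s _ => s.blocks) ?_ ?_ ?_ ?_
  · intro s hs
    simp only [Finset.mem_filter, Finset.mem_univ, true_and] at hs
    exact mem_posLists.2 ⟨hs, s.blocks_sum, fun a ha => s.blocks_pos ha⟩
  · intro s _ s' _ h
    exact Composition.ext h
  · intro b hb
    obtain ⟨h1, h2, h3⟩ := mem_posLists.1 hb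
    exact ⟨⟨b, fun {a} ha => h3 a ha, h2⟩, by simpa [Composition.length] using h1, rfl⟩
  · intros; rfl

theorem coeff_partialSum (f : ℕ → PowerSeries ℝ) (r n : ℕ) :
    PowerSeries.coeff r (partialSum f n) = partialSum (fun j => PowerSeries.coeff r (f j)) n :=
  map_sum _ _ _

theorem partialSum_sum {ι : Type*} (S : Finset ι) (f : ι → ℕ → ℝ) (n : ℕ) :
    partialSum (fun j => ∑ s ∈ S, f s j) n = ∑ s ∈ S, partialSum (f s) n :=
  Finset.sum_comm

theorem coeff_genSeq (l : List ℕ) (r n : ℕ) :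
    PowerSeries.coeff r (genSeq l n) =
      ∑ s ∈ posLists l.length r, mzvSeq (indexAdd l s) n := by
  induction l generalizing r n with
  | nil =>
    cases r with
    | zero => rcases eq_or_ne n 0 with rfl | h <;> simp [genSeq, posLists, indexAdd, mzvSeq, *]
    | succ r =>
      rcases eq_or_ne n 0 with rfl | h <;> simp [genSeq, posLists, PowerSeries.coeff_one, *]
  | cons a l ih =>
    have e : genSeq (a :: l) n = PowerSeries.X * (PowerSeries.C ((n : ℝ)⁻¹ ^ a) *
        (geomInv n * partialSum (genSeq l) n)) := by
      simp only [genSeq, invC, map_pow]; ring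
    rw [e]
    cases r with
    | zero => simp [posLists]
    | succ r =>
      rw [PowerSeries.coeff_succ_X_mul, PowerSeries.coeff_C_mul, PowerSeries.coeff_mul,
        List.length_cons, sum_posLists_succ, Finset.mul_sum]
      refine Finset.sum_congr rfl fun ij _ => ?_
      rw [coeff_partialSum]
      simp only [ih]
      rw [partialSum_sum, Finset.mul_sum, Finset.mul_sum]
      refine Finset.sum_congr rfl fun s _ => ?_
      simp only [indexAdd, List.zipWith_cons_cons, mzvSeq, geomInv, PowerSeries.coeff_mk]
      rw [pow_add _ a]
      ring

/-! ### Generating series for inserted ones. -/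

/-- The sequence `n ↦ ∑_{n = n_1 > ⋯ > n_d} ∏ X / (n_i ^ k_i (n_i + X))`. -/
noncomputable def addSeq : List ℕ → ℕ → PowerSeries ℝ
  | [] => Pi.single 0 1
  | a :: l => fun n => PowerSeries.X * invC n ^ a * addInv n * partialSum (addSeq l) n

/-- `∏_{1 ≤ j ≤ n} (1 + X / j)`. -/
noncomputable def risePochDiv (n : ℕ) : PowerSeries ℝ :=
  ∏ j ∈ Finset.range n, (1 + PowerSeries.X * invC (j + 1))

theorem risePochDiv_succ (n : ℕ) :
    risePochDiv (n + 1) = risePochDiv n * (1 + PowerSeries.X * invC (n + 1)) :=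
  Finset.prod_range_succ _ _

/-- The generating series of `mzvSeq (insertOnes k s)` over the weight of `s`. -/
noncomputable def insertGen (k : List ℕ) (n : ℕ) : PowerSeries ℝ :=
  PowerSeries.mk fun r => ∑ s ∈ posLists k.length r, mzvSeq (insertOnes k s) n

/-- The generating series of `mzvSeq ({1}^b, insertOnes k s)` over `b` plus the weight of `s`. -/
noncomputable def onesGen (k : List ℕ) (n : ℕ) : PowerSeries ℝ :=
  PowerSeries.mk fun r => ∑ ij ∈ Finset.HasAntidiagonal.antidiagonal r, ∑ s ∈ posLists k.length ij.2,
    mzvSeq (List.replicate ij.1 1 ++ insertOnes k s) n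

theorem insertGen_cons (a : ℕ) (k : List ℕ) (n : ℕ) :
    insertGen (a :: k) n =
      PowerSeries.X * invC n ^ (a + 1) * partialSum (onesGen k) n := by
  have e : PowerSeries.X * invC n ^ (a + 1) * partialSum (onesGen k) n =
      PowerSeries.X * (PowerSeries.C ((n : ℝ)⁻¹ ^ (a + 1)) * partialSum (onesGen k) n) := by
    simp only [invC, map_pow]; ring
  rw [e]
  ext r
  cases r with
  | zero => simp [insertGen, posLists]
  | succ r =>
    rw [PowerSeries.coeff_succ_X_mul, PowerSeries.coeff_C_mul, coeff_partialSum]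
    simp only [insertGen, onesGen, PowerSeries.coeff_mk, List.length_cons]
    rw [sum_posLists_succ, partialSum_sum, Finset.mul_sum]
    refine Finset.sum_congr rfl fun ij _ => ?_
    rw [partialSum_sum, Finset.mul_sum]
    refine Finset.sum_congr rfl fun s _ => ?_
    simp [insertOnes, mzvSeq]

/-- The leading block of ones is either empty or loses its first one, at the cost of X/n. -/
theorem onesGen_eq (k : List ℕ) (n : ℕ) :
    onesGen k n = insertGen k n + PowerSeries.X * invC n * partialSum (onesGen k) n := by
  have e : PowerSeries.X * invC n * partialSum (onesGen k) n =
      PowerSeries.X * (PowerSeries.C ((n : ℝ)⁻¹) * partialSum (onesGen k) n) := by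
    simp only [invC]; ring
  rw [e]
  ext r
  cases r with
  | zero => simp [onesGen, insertGen]
  | succ r =>
    rw [map_add, PowerSeries.coeff_succ_X_mul, PowerSeries.coeff_C_mul, coeff_partialSum]
    simp only [insertGen, onesGen, PowerSeries.coeff_mk]
    rw [Finset.Nat.antidiagonal_succ, Finset.sum_cons, Finset.sum_map, partialSum_sum,
      Finset.mul_sum]
    congr 1
    refine Finset.sum_congr rfl fun ij _ => ?_
    rw [partialSum_sum, Finset.mul_sum]
    refine Finset.sum_congr rfl fun s _ => ?_
    simp [mzvSeq, List.replicate_succ]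

theorem insertGen_eq (k : List ℕ) (n : ℕ) :
    insertGen k n = risePochDiv n * addSeq k n := by
  induction k generalizing n with
  | nil =>
    ext r
    rcases eq_or_ne n 0 with rfl | h <;> cases r <;>
      simp [insertGen, posLists, risePochDiv, addSeq, mzvSeq, insertOnes, PowerSeries.coeff_one, *]
  | cons a k ih =>
    -- By `onesGen_eq`, both sides are multiplied by 1 + X/(m+1) and receive the same new term when
    -- m increases.
    have key : ∀ m, partialSum (onesGen k) (m + 1) =
        risePochDiv m * partialSum (addSeq k) (m + 1) := by
      intro m
      induction m with
      | zero =>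
        rw [partialSum_succ, partialSum_zero, partialSum_succ, partialSum_zero, onesGen_eq, ih,
          partialSum_zero]
        simp
      | succ m ihm =>
        rw [partialSum_succ, onesGen_eq, ih, ihm, partialSum_succ (addSeq k) (m + 1),
          risePochDiv_succ]
        ring
    rw [insertGen_cons]
    cases n with
    | zero => simp [partialSum_zero, addSeq]
    | succ m =>
      rw [key, risePochDiv_succ]
      have h1 := natCast_mul_invC (Nat.succ_ne_zero m)
      have h2 := natCast_add_X_mul (Nat.succ_ne_zero m)
      simp only [Nat.succ_eq_add_one] at h1 h2
      simp only [addSeq]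
      set X : PowerSeries ℝ := PowerSeries.X
      have h3 : (1 + X * invC (m + 1)) * addInv (m + 1) = invC (m + 1) := by
        linear_combination invC (m + 1) * h2 - addInv (m + 1) * h1
      linear_combination (-X * invC (m + 1) ^ a * risePochDiv m *
        partialSum (addSeq k) (m + 1)) * h3

/-! ### Refinements and their signed generating series. -/

/-- Add one to the first entry. -/
def incHead : List ℕ → List ℕ
  | [] => []
  | a :: l => (a + 1) :: l

theorem incHead_injective : Function.Injective incHead := by
  rintro (_ | ⟨a, l⟩) (_ | ⟨b, l'⟩) h <;> simp_all [incHead]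

/-- All concatenations of a list of positive integers with sum `a` and a member of `R`. -/
def prependParts (R : Finset (List ℕ)) : ℕ → Finset (List ℕ)
  | 0 => ∅
  | 1 => R.image (List.cons 1)
  | a + 2 => (prependParts R (a + 1)).image incHead ∪
      (prependParts R (a + 1)).image (List.cons 1)

theorem mem_prependParts {R : Finset (List ℕ)} {a : ℕ} {l : List ℕ} :
    l ∈ prependParts R (a + 1) ↔
      ∃ b : List ℕ, b.sum = a + 1 ∧ (∀ c ∈ b, 1 ≤ c) ∧ ∃ l' ∈ R, b ++ l' = l := by
  induction a generalizing l with
  | zero =>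
    simp only [prependParts, Finset.mem_image]
    constructor
    · rintro ⟨l', h, rfl⟩
      exact ⟨[1], by simp, by simp, l', h, rfl⟩
    · rintro ⟨b, h1, h2, l', h3, rfl⟩
      refine ⟨l', h3, ?_⟩
      match b, h1, h2 with
      | [c], h1, h2 => simp at h1; simp [h1]
      | c :: d :: b, h1, h2 =>
        have := h2 c (by simp)
        have := h2 d (by simp)
        simp at h1
        omega
  | succ a ih =>
    rw [prependParts, Finset.mem_union, Finset.mem_image, Finset.mem_image]
    simp only [ih]
    constructor
    · rintro (⟨_, ⟨b, h1, h2, l', h3, rfl⟩, rfl⟩ | ⟨_, ⟨b, h1, h2, l', h3, rfl⟩, rfl⟩)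
      · cases b with
        | nil => simp at h1
        | cons c b =>
          refine ⟨(c + 1) :: b, by simp at h1 ⊢; omega, ?_, l', h3, rfl⟩
          simp only [List.mem_cons, forall_eq_or_imp] at h2 ⊢
          exact ⟨by omega, h2.2⟩
      · refine ⟨1 :: b, by simp [h1]; omega, by simpa using h2, l', h3, rfl⟩
    · rintro ⟨b, h1, h2, l', h3, rfl⟩
      match b, h1, h2 with
      | c :: b, h1, h2 =>
        simp only [List.sum_cons, List.mem_cons, forall_eq_or_imp] at h1 h2
        rcases Nat.eq_or_lt_of_le h2.1 with h | h
        · right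
          exact ⟨b ++ l', ⟨b, by omega, h2.2, l', h3, rfl⟩, by simp [h]⟩
        · left
          refine ⟨(c - 1) :: b ++ l', ⟨(c - 1) :: b, by simp; omega, ?_, l', h3, rfl⟩, ?_⟩
          · simp only [List.mem_cons, forall_eq_or_imp]
            exact ⟨by omega, h2.2⟩
          · simp [incHead]; omega

/-- The refinements of an index. -/
def refinements (k : List ℕ) : Finset (List ℕ) :=
  k.foldr (fun a R => prependParts R a) {[]}

theorem mem_refinements {k l : List ℕ} (hk : ∀ a ∈ k, 1 ≤ a) :
    l ∈ refinements k ↔ Refines l k ∧ ∀ a ∈ l, 1 ≤ a := by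
  induction k generalizing l with
  | nil =>
    simp only [refinements, List.foldr_nil, Finset.mem_singleton]
    constructor
    · rintro rfl
      exact ⟨⟨[], by simp⟩, by simp⟩
    · rintro ⟨⟨B, -, rfl, h⟩, -⟩
      simp only [List.map_eq_nil_iff] at h
      simp [h]
  | cons a k ih =>
    have ha := hk a (by simp)
    have ih := fun l => ih (l := l) fun c hc => hk c (by simp [hc])
    obtain ⟨a, rfl⟩ := Nat.exists_eq_add_of_le' ha
    change l ∈ prependParts (refinements k) (a + 1) ↔ _
    rw [mem_prependParts]
    simp only [ih]
    constructor
    · rintro ⟨b, h1, h2, l', ⟨⟨B, h3, rfl, h4⟩, h5⟩, rfl⟩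
      refine ⟨⟨b :: B, ?_, by simp, by simp [h1, h4]⟩, ?_⟩
      · simp only [List.mem_cons, forall_eq_or_imp]
        refine ⟨?_, h3⟩
        rintro rfl
        simp at h1
      · intro c hc
        rcases List.mem_append.1 hc with h | h
        · exact h2 c h
        · exact h5 c h
    · rintro ⟨⟨B, h1, rfl, h2⟩, h3⟩
      match B, h1, h2, h3 with
      | b :: B, h1, h2, h3 =>
        simp only [List.map_cons, List.cons.injEq] at h2
        refine ⟨b, h2.1, fun c hc => h3 c (by simp [hc]), B.flatten,
          ⟨⟨B, fun c hc => h1 c (by simp [hc]), rfl, h2.2⟩, fun c hc => h3 c ?_⟩, by simp⟩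
        rw [List.flatten_cons]
        exact List.mem_append_right _ hc

theorem Refines.sum_eq {l k : List ℕ} (h : Refines l k) : l.sum = k.sum := by
  obtain ⟨B, -, rfl, rfl⟩ := h
  exact List.sum_flatten

theorem Refines.length_le {l k : List ℕ} (h : Refines l k) : k.length ≤ l.length := by
  obtain ⟨B, h, rfl, rfl⟩ := h
  induction B with
  | nil => simp
  | cons b B ih =>
    have := ih fun c hc => h c (by simp [hc])
    have := List.length_pos_iff.2 (h b (by simp))
    simp only [List.map_cons, List.length_cons, List.flatten_cons, List.length_append]
    omega

theorem sum_composition_eq_sum_refinements {M : Type*} [AddCommMonoid M] {k : List ℕ}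
    (hk : ∀ a ∈ k, 1 ≤ a) (p : ℕ → Prop) [DecidablePred p]
    [DecidablePred fun c : Composition k.sum => Refines c.blocks k ∧ p c.length]
    (f : List ℕ → M) :
    ∑ c : Composition k.sum with Refines c.blocks k ∧ p c.length, f c.blocks =
      ∑ l ∈ refinements k with p l.length, f l := by
  refine Finset.sum_bij (fun s _ => s.blocks) ?_ ?_ ?_ ?_
  · intro s hs
    simp only [Finset.mem_filter, Finset.mem_univ, true_and] at hs
    exact Finset.mem_filter.2 ⟨(mem_refinements hk).2 ⟨hs.1, fun a ha => s.blocks_pos ha⟩, hs.2⟩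
  · intro s _ s' _ h
    exact Composition.ext h
  · intro b hb
    obtain ⟨hb, hp⟩ := Finset.mem_filter.1 hb
    obtain ⟨h1, h2⟩ := (mem_refinements hk).1 hb
    exact ⟨⟨b, fun {a} ha => h2 a ha, h1.sum_eq⟩, Finset.mem_filter.2 ⟨by simp, h1, hp⟩, rfl⟩
  · intros; rfl

/-- The signed sum of the generating series over all refinements of `k`. -/
noncomputable def refineGen (k : List ℕ) (n : ℕ) : PowerSeries ℝ :=
  ∑ l ∈ refinements k, (-1) ^ (l.length + k.length) * genSeq l n

theorem partialSum_signed (R : Finset (List ℕ)) (e : ℕ) (n : ℕ) :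
    partialSum (fun j => ∑ l ∈ R, (-1) ^ (l.length + e) * genSeq l j) n =
      ∑ l ∈ R, (-1) ^ (l.length + e) * partialSum (genSeq l) n := by
  simp only [partialSum, Finset.mul_sum]
  exact Finset.sum_comm

theorem refineGen_nil : refineGen [] = Pi.single 0 1 := by
  ext1 n
  simp [refineGen, refinements, genSeq]

theorem refineGen_one_cons (k : List ℕ) (n : ℕ) : refineGen (1 :: k) n =
    PowerSeries.X * invC n * geomInv n * partialSum (refineGen k) n := by
  unfold refineGen
  rw [partialSum_signed, Finset.mul_sum]
  change ∑ l ∈ (refinements k).image (List.cons 1), _ = _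
  rw [Finset.sum_image (fun a _ b _ h => by simpa using h)]
  refine Finset.sum_congr rfl fun l _ => ?_
  simp only [List.length_cons, genSeq]
  ring

/-- A refinement with first block of sum a + 2 starts either with a part at least 2, which can be
lowered, or with a part 1, which can be removed. The removal changes the depth and hence the sign.
-/
theorem refineGen_succ_cons (a : ℕ) (k : List ℕ) (n : ℕ) : refineGen ((a + 2) :: k) n =
    invC n * refineGen ((a + 1) :: k) n -
      PowerSeries.X * invC n * geomInv n * partialSum (refineGen ((a + 1) :: k)) n := by
  unfold refineGen
  rw [partialSum_signed, Finset.mul_sum, Finset.mul_sum]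
  change ∑ l ∈ (refinements ((a + 1) :: k)).image incHead ∪
    (refinements ((a + 1) :: k)).image (List.cons 1), _ = _
  have hmem : ∀ l ∈ refinements ((a + 1) :: k), ∃ c l', l = (c + 1) :: l' := by
    intro l hl
    obtain ⟨b, h1, h2, l', -, rfl⟩ := mem_prependParts.1 hl
    cases b with
    | nil => simp at h1
    | cons c b =>
      obtain ⟨c, rfl⟩ := Nat.exists_eq_add_of_le' (h2 c (by simp))
      exact ⟨c, b ++ l', rfl⟩
  rw [Finset.sum_union, Finset.sum_image incHead_injective.injOn,
    Finset.sum_image (fun a _ b _ h => by simpa using h), sub_eq_add_neg, ← Finset.sum_neg_distrib]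
  · congr 1
    · refine Finset.sum_congr rfl fun l hl => ?_
      obtain ⟨c, l', rfl⟩ := hmem l hl
      simp only [incHead, List.length_cons, genSeq]
      ring
    · refine Finset.sum_congr rfl fun l hl => ?_
      simp only [List.length_cons, genSeq]
      ring
  -- Parts are positive, so an incremented head is never 1.
  · rw [Finset.disjoint_left]
    intro x hx hx'
    obtain ⟨l, hl, rfl⟩ := Finset.mem_image.1 hx
    obtain ⟨l2, hl2, h⟩ := Finset.mem_image.1 hx'
    obtain ⟨c, l', rfl⟩ := hmem l hl
    simp [incHead] at h

/-- The recursions of `refineGen` match the two moves exactly; the inner induction raises the head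
from 1. -/
theorem kernelRelated_refineGen {k : List ℕ} (hk : ∀ a ∈ k, 1 ≤ a) :
    KernelRelated (refineGen k) (addSeq k) := by
  induction k with
  | nil =>
    rw [refineGen_nil]
    exact kernelRelated_single
  | cons a k ih =>
    have ih := ih fun c hc => hk c (by simp [hc])
    obtain ⟨a, rfl⟩ := Nat.exists_eq_add_of_le' (hk a (by simp))
    clear hk
    induction a with
    | zero =>
      convert ih.cons_one using 1
      · exact funext fun n => refineGen_one_cons k n
      · funext n
        simp [addSeq]
    | succ a iha =>
      convert iha.succ_head (by simp [addSeq, partialSum_zero]) using 1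
      · exact funext fun n => refineGen_succ_cons a k n
      · funext n
        simp only [addSeq]
        ring

theorem coeff_partialSum_refineGen (k : List ℕ) (r n : ℕ) :
    PowerSeries.coeff r (partialSum (refineGen k) n) =
      ∑ l ∈ refinements k, ∑ s ∈ posLists l.length r,
        (-1) ^ (l.length + k.length) * partialSum (mzvSeq (indexAdd l s)) n := by
  unfold refineGen
  rw [partialSum_signed, map_sum]
  refine Finset.sum_congr rfl fun l _ => ?_
  have : ((-1) ^ (l.length + k.length) : PowerSeries ℝ) =
      PowerSeries.C ((-1) ^ (l.length + k.length)) := by simp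
  rw [this, PowerSeries.coeff_C_mul, coeff_partialSum]
  simp only [coeff_genSeq]
  rw [partialSum_sum, Finset.mul_sum]

/-! ### Convergence and harmonic bounds. -/

/-- An index whose multiple zeta series converges. -/
def Admissible (l : List ℕ) : Prop :=
  (∀ a ∈ l, 1 ≤ a) ∧ ∃ a t, l = a :: t ∧ 2 ≤ a

/-- `1` plus the `n`-th harmonic number. -/
noncomputable def harmonicBound (n : ℕ) : ℝ := 1 + (harmonic n : ℝ)

theorem harmonicBound_succ (n : ℕ) :
    harmonicBound (n + 1) = harmonicBound n + ((n + 1 : ℕ) : ℝ)⁻¹ := by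
  simp only [harmonicBound, harmonic_succ]
  push_cast
  ring

theorem harmonicBound_mono : Monotone harmonicBound :=
  monotone_nat_of_le_succ fun n => by
    rw [harmonicBound_succ]
    exact le_add_of_nonneg_right (by positivity)

theorem one_le_harmonicBound (n : ℕ) : 1 ≤ harmonicBound n := by
  have := harmonicBound_mono (Nat.zero_le n)
  simpa [harmonicBound] using this

theorem partialSum_inv_le (n : ℕ) :
    partialSum (fun j : ℕ => (j : ℝ)⁻¹) n ≤ harmonicBound n := by
  have : ∀ n, partialSum (fun j : ℕ => (j : ℝ)⁻¹) (n + 1) ≤ harmonicBound n := by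
    intro n
    induction n with
    | zero => simp [partialSum, harmonicBound]
    | succ n ih =>
      rw [partialSum_succ, harmonicBound_succ]
      gcongr
  cases n with
  | zero => simp [partialSum, harmonicBound]
  | succ n => exact (this n).trans (harmonicBound_mono n.le_succ)

theorem mzvSeq_nonneg (l : List ℕ) (n : ℕ) : 0 ≤ mzvSeq l n := by
  induction l generalizing n with
  | nil => rcases eq_or_ne n 0 with rfl | h <;> simp [mzvSeq, *]
  | cons a l ih =>
    exact mul_nonneg (by positivity) (Finset.sum_nonneg fun j _ => ih j)

theorem inv_pow_le_inv_pow (n : ℕ) {a b : ℕ} (ha : 1 ≤ a) (h : a ≤ b) :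
    (n : ℝ)⁻¹ ^ b ≤ (n : ℝ)⁻¹ ^ a := by
  rcases Nat.eq_zero_or_pos n with rfl | hn
  · simp [show a ≠ 0 by omega, show b ≠ 0 by omega]
  · exact pow_le_pow_of_le_one (by positivity) (inv_le_one_of_one_le₀ (by exact_mod_cast hn)) h

/-- Lower every exponent to 1 and let each variable range freely below n. -/
theorem partialSum_mzvSeq_le {l : List ℕ} (hl : ∀ a ∈ l, 1 ≤ a) (n : ℕ) :
    partialSum (mzvSeq l) n ≤ harmonicBound n ^ l.length := by
  induction l generalizing n with
  | nil =>
    cases n with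
    | zero => simp [partialSum]
    | succ n => simp [partialSum, mzvSeq]
  | cons a l ih =>
    have ih := ih fun c hc => hl c (by simp [hc])
    have ha := hl a (by simp)
    calc partialSum (mzvSeq (a :: l)) n
        ≤ ∑ j ∈ Finset.range n, (j : ℝ)⁻¹ * harmonicBound n ^ l.length := by
          refine Finset.sum_le_sum fun j hj => ?_
          refine mul_le_mul ?_ ((ih j).trans ?_)
            (Finset.sum_nonneg fun i _ => mzvSeq_nonneg l i) (by positivity)
          · simpa using inv_pow_le_inv_pow j le_rfl ha
          · exact pow_le_pow_left₀ (zero_le_one.trans (one_le_harmonicBound j))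
              (harmonicBound_mono (Finset.mem_range.1 hj).le) _
      _ ≤ harmonicBound n * harmonicBound n ^ l.length := by
          rw [← Finset.sum_mul]
          exact mul_le_mul_of_nonneg_right (partialSum_inv_le n)
            (pow_nonneg (zero_le_one.trans (one_le_harmonicBound n)) _)
      _ = _ := by rw [List.length_cons, pow_succ']

theorem Admissible.mzvSeq_le {l : List ℕ} (hl : Admissible l) (n : ℕ) :
    mzvSeq l n ≤ (n : ℝ)⁻¹ ^ 2 * harmonicBound n ^ l.length := by
  obtain ⟨h, a, t, rfl, ha⟩ := hl
  refine mul_le_mul (inv_pow_le_inv_pow n one_le_two ha) ?_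
    (Finset.sum_nonneg fun i _ => mzvSeq_nonneg t i) (by positivity)
  refine (partialSum_mzvSeq_le (fun c hc => h c (by simp [hc])) n).trans ?_
  exact pow_le_pow_right₀ (one_le_harmonicBound n) (by simp)

theorem summable_inv_sq_mul_harmonicBound_pow (D : ℕ) :
    Summable fun n : ℕ => (n : ℝ)⁻¹ ^ 2 * harmonicBound n ^ D := by
  have h1 : (fun n : ℕ => harmonicBound n) =O[Filter.atTop] fun n : ℕ => Real.log n := by
    -- `harmonicBound n` is at most 2 + log n, hence at most 3 log n once log n ≥ 1.
    refine Asymptotics.IsBigO.of_bound 3 ?_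
    have hlog : ∀ᶠ n : ℕ in Filter.atTop, 1 ≤ Real.log n :=
      (Real.tendsto_log_atTop.comp tendsto_natCast_atTop_atTop).eventually_ge_atTop 1
    filter_upwards [hlog] with n hn
    rw [Real.norm_of_nonneg (zero_le_one.trans (one_le_harmonicBound n)),
      Real.norm_of_nonneg (by linarith)]
    have := harmonic_le_one_add_log n
    simp only [harmonicBound]
    linarith
  -- The exponent 1/2 leaves n^(-3/2), still summable.
  have h2 : (fun n : ℕ => Real.log n ^ D) =O[Filter.atTop] fun n : ℕ => (n : ℝ) ^ (1 / 2 : ℝ) := by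
    have := (isLittleO_log_rpow_rpow_atTop (D : ℝ) (show (0 : ℝ) < 1 / 2 by norm_num)).isBigO
    simpa [Function.comp_def] using this.comp_tendsto tendsto_natCast_atTop_atTop
  have h3 : (fun n : ℕ => (n : ℝ)⁻¹ ^ 2 * harmonicBound n ^ D) =O[Filter.atTop]
      fun n : ℕ => (n : ℝ)⁻¹ ^ 2 * (n : ℝ) ^ (1 / 2 : ℝ) :=
    (Asymptotics.isBigO_refl _ _).mul ((h1.pow D).trans h2)
  refine summable_of_isBigO_nat (g := fun n : ℕ => (n : ℝ) ^ (-(3 / 2) : ℝ))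
    (Real.summable_nat_rpow.2 (by norm_num)) (h3.congr' (by rfl) ?_)
  filter_upwards [Filter.eventually_gt_atTop 0] with n hn
  have hn : (0 : ℝ) < n := by exact_mod_cast hn
  rw [inv_pow, ← Real.rpow_natCast, ← Real.rpow_neg hn.le, ← Real.rpow_add hn]
  norm_num

theorem Admissible.summable_mzvSeq {l : List ℕ} (hl : Admissible l) : Summable (mzvSeq l) :=
  Summable.of_nonneg_of_le (mzvSeq_nonneg l) hl.mzvSeq_le
    (summable_inv_sq_mul_harmonicBound_pow l.length)

/-! ### The limit of the kernel. -/

/-- The geometric series `1 / (1 - X / y)`. -/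
noncomputable def geomUnit (y : ℕ) : PowerSeries ℝ :=
  PowerSeries.mk fun j => (y : ℝ)⁻¹ ^ j

theorem geomUnit_eq {y : ℕ} (hy : y ≠ 0) : geomUnit y = (y : PowerSeries ℝ) * geomInv y := by
  have : (y : PowerSeries ℝ) = PowerSeries.C (y : ℝ) := by simp
  rw [this]
  ext j
  rw [PowerSeries.coeff_C_mul]
  simp only [geomUnit, geomInv, PowerSeries.coeff_mk]
  rw [pow_succ', ← mul_assoc, mul_inv_cancel₀ (by exact_mod_cast hy), one_mul]

theorem natCast_sub_X_mul_geomUnit {y : ℕ} (hy : y ≠ 0) :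
    ((y : PowerSeries ℝ) - PowerSeries.X) * geomUnit y = (y : PowerSeries ℝ) := by
  rw [geomUnit_eq hy]
  linear_combination (y : PowerSeries ℝ) * natCast_sub_X_mul hy

theorem coeff_prod_geomUnit_nonneg (s : Finset ℕ) (y : ℕ → ℕ) (r : ℕ) :
    0 ≤ PowerSeries.coeff r (∏ i ∈ s, geomUnit (y i)) := by
  induction s using Finset.induction_on generalizing r with
  | empty =>
    rw [Finset.prod_empty, PowerSeries.coeff_one]
    split_ifs <;> norm_num
  | insert a s ha ih =>
    rw [Finset.prod_insert ha, PowerSeries.coeff_mul]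
    refine Finset.sum_nonneg fun ij _ => mul_nonneg ?_ (ih _)
    simp only [geomUnit, PowerSeries.coeff_mk]
    positivity

/-- The coefficient is a complete homogeneous polynomial in the 1/y_i; the power of their sum has
the same monomials with multinomial coefficients at least 1. -/
theorem coeff_prod_geomUnit_le (s : Finset ℕ) (y : ℕ → ℕ) (r : ℕ) :
    PowerSeries.coeff r (∏ i ∈ s, geomUnit (y i)) ≤ (∑ i ∈ s, (y i : ℝ)⁻¹) ^ r := by
  induction s using Finset.induction_on generalizing r with
  | empty =>
    rw [Finset.prod_empty, PowerSeries.coeff_one]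
    cases r <;> simp
  | insert a s ha ih =>
    have h0 : (0 : ℝ) ≤ ∑ i ∈ s, (y i : ℝ)⁻¹ := Finset.sum_nonneg fun i _ => by positivity
    rw [Finset.prod_insert ha, PowerSeries.coeff_mul, Finset.sum_insert ha,
      (Commute.all _ _).add_pow']
    refine Finset.sum_le_sum fun ij hij => ?_
    have h1 : (y a : ℝ)⁻¹ ^ ij.1 * PowerSeries.coeff ij.2 (∏ i ∈ s, geomUnit (y i)) ≤
        (y a : ℝ)⁻¹ ^ ij.1 * (∑ i ∈ s, (y i : ℝ)⁻¹) ^ ij.2 :=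
      mul_le_mul_of_nonneg_left (ih _) (by positivity)
    have h2 : 1 ≤ r.choose ij.1 := by
      apply Nat.choose_pos
      have := Finset.HasAntidiagonal.mem_antidiagonal.1 hij
      omega
    simp only [geomUnit, PowerSeries.coeff_mk] at h1 ⊢
    rw [nsmul_eq_mul]
    refine h1.trans (le_mul_of_one_le_left (by positivity) (by exact_mod_cast h2))

/-- `∏_{M - n < j ≤ M} 1 / (1 - X / j)`. -/
noncomputable def geomProd (M n : ℕ) : PowerSeries ℝ :=
  ∏ i ∈ Finset.range n, geomUnit (M - i)

theorem kernel_eq_mul_geomProd {M n : ℕ} (h : n ≤ M) :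
    kernel M n = risePochDiv n * geomProd M n := by
  induction n with
  | zero => simp [kernel_zero_right, risePochDiv, geomProd]
  | succ n ih =>
    have ih := ih (by omega)
    have hg : geomProd M (n + 1) = geomProd M n * geomUnit (M - n) := Finset.prod_range_succ _ _
    obtain ⟨q, rfl⟩ := Nat.exists_eq_add_of_lt h
    have e1 : n + q + 1 - n = q + 1 := by omega
    have e2 : n + q + 1 - (n + 1) = q := by omega
    have h1 := kernel_mul (n + q + 1) (n + 1)
    have h2 := kernel_mul (n + q + 1) n
    have h3 := natCast_sub_X_mul_geomUnit (Nat.succ_ne_zero q)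
    have h4 := natCast_mul_invC (Nat.succ_ne_zero n)
    rw [e1] at hg h2
    rw [e2, risePoch_succ] at h1
    rw [fallPoch_succ q, fallPoch_succ (n + q)] at h2
    have h5 : ((n + q + 1).choose (n + 1) : PowerSeries ℝ) * (n + 1) =
        (n + q + 1).choose n * (q + 1) := by
      have := Nat.choose_succ_right_eq (n + q + 1) n
      rw [e1] at this
      simpa using congrArg (Nat.cast (R := PowerSeries ℝ)) this
    rw [hg, risePochDiv_succ]
    apply mul_right_cancel₀ (fallPoch_ne_zero (n + q + 1))
    have h6 : risePochDiv n * (1 + PowerSeries.X * invC (n + 1)) *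
        (geomProd (n + q + 1) n * geomUnit (q + 1)) * fallPoch (n + q + 1) =
        (kernel (n + q + 1) n * fallPoch (n + q + 1)) *
          ((1 + PowerSeries.X * invC (n + 1)) * geomUnit (q + 1)) := by
      rw [ih]; ring
    rw [h6, fallPoch_succ (n + q), h2, ← fallPoch_succ, h1]
    simp only [Nat.succ_eq_add_one, Nat.cast_add, Nat.cast_one] at h3 h4 ⊢
    set X : PowerSeries ℝ := PowerSeries.X
    set c := ((n + q + 1).choose n : PowerSeries ℝ)
    linear_combination (-c * risePoch n * fallPoch q * (1 + X * invC (n + 1))) * h3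
      + risePoch n * fallPoch q * (1 + X * invC (n + 1)) * h5
      - ((n + q + 1).choose (n + 1) : PowerSeries ℝ) * risePoch n * fallPoch q * X * h4

/-- The bound does not depend on M, as the dominated convergence requires. -/
theorem sum_inv_sub_le {M n : ℕ} (h : n ≤ M) :
    ∑ i ∈ Finset.range n, ((M - i : ℕ) : ℝ)⁻¹ ≤ harmonicBound n := by
  calc ∑ i ∈ Finset.range n, ((M - i : ℕ) : ℝ)⁻¹
      ≤ ∑ i ∈ Finset.range n, ((n - 1 - i + 1 : ℕ) : ℝ)⁻¹ := by
        refine Finset.sum_le_sum fun i hi => ?_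
        have := Finset.mem_range.1 hi
        apply inv_anti₀ (by positivity)
        exact_mod_cast (by omega : n - 1 - i + 1 ≤ M - i)
    _ = ∑ i ∈ Finset.range n, ((i + 1 : ℕ) : ℝ)⁻¹ :=
        Finset.sum_range_reflect (fun i => ((i + 1 : ℕ) : ℝ)⁻¹) n
    _ ≤ harmonicBound n := by
        simp [harmonicBound, harmonic]

theorem coeff_geomProd_nonneg (M n j : ℕ) : 0 ≤ PowerSeries.coeff j (geomProd M n) :=
  coeff_prod_geomUnit_nonneg _ _ _

theorem coeff_geomProd_le {M n : ℕ} (h : n ≤ M) (j : ℕ) :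
    PowerSeries.coeff j (geomProd M n) ≤ harmonicBound n ^ j :=
  (coeff_prod_geomUnit_le _ _ _).trans
    (pow_le_pow_left₀ (Finset.sum_nonneg fun i _ => by positivity) (sum_inv_sub_le h) j)

theorem tendsto_coeff_geomProd (n j : ℕ) :
    Filter.Tendsto (fun M => PowerSeries.coeff j (geomProd M n)) Filter.atTop
      (nhds (if j = 0 then 1 else 0)) := by
  rcases eq_or_ne j 0 with rfl | hj
  · have : ∀ M, PowerSeries.coeff 0 (geomProd M n) = 1 := by
      intro M
      rw [PowerSeries.coeff_zero_eq_constantCoeff_apply, geomProd, map_prod]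
      refine Finset.prod_eq_one fun i _ => ?_
      rw [← PowerSeries.coeff_zero_eq_constantCoeff_apply]
      simp [geomUnit]
    simp [this]
  · rw [if_neg hj]
    have h : Filter.Tendsto (fun M : ℕ => (∑ i ∈ Finset.range n, ((M - i : ℕ) : ℝ)⁻¹) ^ j)
        Filter.atTop (nhds 0) := by
      have : Filter.Tendsto (fun M : ℕ => ∑ i ∈ Finset.range n, ((M - i : ℕ) : ℝ)⁻¹)
          Filter.atTop (nhds (∑ i ∈ Finset.range n, 0)) :=
        tendsto_finsetSum _ fun i _ =>
          (tendsto_inv_atTop_nhds_zero_nat (𝕜 := ℝ)).comp (Filter.tendsto_sub_atTop_nat i)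
      simpa [hj] using this.pow j
    exact squeeze_zero (fun M => coeff_prod_geomUnit_nonneg _ _ _)
      (fun M => coeff_prod_geomUnit_le _ _ _) h

theorem tendsto_sum_kernel {k : List ℕ} {r : ℕ}
    (hk : ∀ i, ∀ s ∈ posLists k.length i, Admissible (insertOnes k s)) :
    Filter.Tendsto (fun M => PowerSeries.coeff r
        (∑ n ∈ Finset.range (M + 1), kernel M n * addSeq k n)) Filter.atTop
      (nhds (∑ s ∈ posLists k.length r, ∑' n, mzvSeq (insertOnes k s) n)) := by
  have coeff_eq : ∀ M n, n ≤ M → PowerSeries.coeff r (kernel M n * addSeq k n) =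
      ∑ ij ∈ Finset.HasAntidiagonal.antidiagonal r,
        PowerSeries.coeff ij.1 (insertGen k n) * PowerSeries.coeff ij.2 (geomProd M n) := by
    intro M n h
    rw [kernel_eq_mul_geomProd h, ← PowerSeries.coeff_mul, insertGen_eq]
    congr 1
    ring
  have ins_nonneg : ∀ i n, 0 ≤ PowerSeries.coeff i (insertGen k n) := fun i n => by
    rw [insertGen, PowerSeries.coeff_mk]
    exact Finset.sum_nonneg fun s _ => mzvSeq_nonneg _ _
  -- Extension by zero beyond M turns the finite sums into series over a fixed index set.
  let f : ℕ → ℕ → ℝ := fun M n =>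
    if n ≤ M then PowerSeries.coeff r (kernel M n * addSeq k n) else 0
  let bound : ℕ → ℝ := fun n => ∑ ij ∈ Finset.HasAntidiagonal.antidiagonal r,
    PowerSeries.coeff ij.1 (insertGen k n) * harmonicBound n ^ ij.2
  have hbound : Summable bound := by
    refine summable_sum fun ij _ => ?_
    simp only [insertGen, PowerSeries.coeff_mk, Finset.sum_mul]
    refine summable_sum fun s hs => ?_
    refine Summable.of_nonneg_of_le (fun n => ?_) (fun n => ?_)
      (summable_inv_sq_mul_harmonicBound_pow ((insertOnes k s).length + ij.2))
    · exact mul_nonneg (mzvSeq_nonneg _ _)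
        (pow_nonneg (zero_le_one.trans (one_le_harmonicBound n)) _)
    · rw [pow_add, ← mul_assoc]
      exact mul_le_mul_of_nonneg_right ((hk _ s hs).mzvSeq_le n)
        (pow_nonneg (zero_le_one.trans (one_le_harmonicBound n)) _)
  have hlim : ∀ n, Filter.Tendsto (fun M => f M n) Filter.atTop
      (nhds (PowerSeries.coeff r (insertGen k n))) := by
    intro n
    have h1 : Filter.Tendsto (fun M => ∑ ij ∈ Finset.HasAntidiagonal.antidiagonal r,
        PowerSeries.coeff ij.1 (insertGen k n) * PowerSeries.coeff ij.2 (geomProd M n))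
        Filter.atTop (nhds (∑ ij ∈ Finset.HasAntidiagonal.antidiagonal r,
          PowerSeries.coeff ij.1 (insertGen k n) * if ij.2 = 0 then 1 else 0)) :=
      tendsto_finsetSum _ fun ij _ => (tendsto_coeff_geomProd n ij.2).const_mul _
    have h2 : (∑ ij ∈ Finset.HasAntidiagonal.antidiagonal r,
        PowerSeries.coeff ij.1 (insertGen k n) * if ij.2 = 0 then 1 else 0) =
        PowerSeries.coeff r (insertGen k n) := by
      rw [Finset.sum_eq_single (r, 0)]
      · simp
      · rintro ⟨i, j⟩ hij hne
        have hij := Finset.HasAntidiagonal.mem_antidiagonal.1 hij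
        have : j ≠ 0 := by
          rintro rfl
          exact hne (by simpa using hij)
        simp [this]
      · intro h
        exact absurd (Finset.HasAntidiagonal.mem_antidiagonal.2 (by simp)) h
    rw [h2] at h1
    refine h1.congr' ?_
    filter_upwards [Filter.eventually_ge_atTop n] with M hM
    simp only [f, if_pos hM, coeff_eq M n hM]
  have hdom := tendsto_tsum_of_dominated_convergence (f := f) hbound hlim
    (Filter.Eventually.of_forall fun M n => by
      by_cases h : n ≤ M
      · simp only [f, if_pos h, coeff_eq M n h]
        rw [Real.norm_of_nonneg (Finset.sum_nonneg fun ij _ =>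
          mul_nonneg (ins_nonneg _ _) (coeff_geomProd_nonneg _ _ _))]
        exact Finset.sum_le_sum fun ij _ =>
          mul_le_mul_of_nonneg_left (coeff_geomProd_le h _) (ins_nonneg _ _)
      · simp only [f, if_neg h, norm_zero]
        exact Finset.sum_nonneg fun ij _ => mul_nonneg (ins_nonneg _ _)
          (pow_nonneg (zero_le_one.trans (one_le_harmonicBound n)) _))
  have e1 : ∑' n, PowerSeries.coeff r (insertGen k n) =
      ∑ s ∈ posLists k.length r, ∑' n, mzvSeq (insertOnes k s) n := by
    simp only [insertGen, PowerSeries.coeff_mk]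
    exact Summable.tsum_finsetSum fun s hs => (hk r s hs).summable_mzvSeq
  rw [← e1]
  refine hdom.congr fun M => ?_
  rw [tsum_eq_sum (s := Finset.range (M + 1)), map_sum]
  · refine Finset.sum_congr rfl fun n hn => ?_
    have := Finset.mem_range.1 hn
    simp only [f, if_pos (show n ≤ M by omega)]
  · intro n hn
    have : ¬ n ≤ M := fun h => hn (Finset.mem_range.2 (by omega))
    simp only [f, if_neg this]

/-! ### Sums over decreasing tuples as iterated sums. -/

open Classical in
/-- The strictly decreasing tuples of positive integers below `N`. -/
noncomputable def boundedTuples (d N : ℕ) : Finset (Fin d → ℕ) :=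
  (Fintype.piFinset fun _ => Finset.Ico 1 N).filter StrictAnti

theorem mem_boundedTuples {d N : ℕ} {n : Fin d → ℕ} :
    n ∈ boundedTuples d N ↔ (∀ i, 1 ≤ n i ∧ n i < N) ∧ StrictAnti n := by
  simp [boundedTuples]

theorem strictAnti_cons {d j : ℕ} {n : Fin d → ℕ} :
    StrictAnti (Fin.cons j n : Fin (d + 1) → ℕ) ↔ (∀ i, n i < j) ∧ StrictAnti n := by
  constructor
  · intro h
    refine ⟨fun i => ?_, fun a b hab => ?_⟩
    · simpa using h (Fin.succ_pos i)
    · simpa using h (Fin.succ_lt_succ_iff.2 hab)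
  · rintro ⟨h1, h2⟩ a b hab
    induction b using Fin.cases with
    | zero => exact absurd hab (Fin.not_lt_zero _)
    | succ b =>
      induction a using Fin.cases with
      | zero => simpa using h1 b
      | succ a => simpa using h2 (Fin.succ_lt_succ_iff.1 hab)

/-- Split off the largest entry. The bound on N matters for the empty index, where the empty tuple
contributes 1 but the partial sum at 0 is 0. -/
theorem sum_boundedTuples {l : List ℕ} (hl : ∀ a ∈ l, 1 ≤ a) {N : ℕ} (hN : 1 ≤ N) :
    ∑ n ∈ boundedTuples l.length N, ∏ i, (n i : ℝ)⁻¹ ^ l.get i = partialSum (mzvSeq l) N := by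
  induction l generalizing N with
  | nil =>
    have : boundedTuples 0 N = {Fin.elim0} := by
      ext n
      rw [mem_boundedTuples, Finset.mem_singleton]
      exact ⟨fun _ => Subsingleton.elim _ _, fun _ => ⟨fun i => i.elim0, fun i => i.elim0⟩⟩
    simp only [List.length_nil, this]
    obtain ⟨N, rfl⟩ := Nat.exists_eq_add_of_le' hN
    simp [partialSum, mzvSeq]
  | cons a l ih =>
    have ha := hl a (by simp)
    have ih := fun (j : ℕ) (hj : 1 ≤ j) => ih (fun c hc => hl c (by simp [hc])) hj
    have e : partialSum (mzvSeq (a :: l)) N = ∑ j ∈ Finset.Ico 1 N,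
        ∑ n ∈ boundedTuples l.length j, (j : ℝ)⁻¹ ^ a * ∏ i, (n i : ℝ)⁻¹ ^ l.get i := by
      rw [partialSum, Finset.range_eq_Ico, Finset.sum_eq_sum_Ico_succ_bot (by omega)]
      have h0 : mzvSeq (a :: l) 0 = 0 := by simp [mzvSeq, partialSum]
      rw [h0, zero_add]
      refine Finset.sum_congr rfl fun j hj => ?_
      rw [← Finset.mul_sum, ih j (Finset.mem_Ico.1 hj).1]
      rfl
    rw [e, Finset.sum_sigma']
    refine Finset.sum_bij' (fun n _ => ⟨n 0, Fin.tail n⟩) (fun x _ => Fin.cons x.1 x.2)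
      ?_ ?_ ?_ ?_ ?_
    · intro n hn
      obtain ⟨h1, h2⟩ := mem_boundedTuples.1 hn
      rw [← Fin.cons_self_tail n, strictAnti_cons] at h2
      exact Finset.mem_sigma.2 ⟨Finset.mem_Ico.2 (h1 0),
        mem_boundedTuples.2 ⟨fun i => ⟨(h1 i.succ).1, h2.1 i⟩, h2.2⟩⟩
    · rintro ⟨j, n⟩ hx
      obtain ⟨h1, h2⟩ := Finset.mem_sigma.1 hx
      have h1 := Finset.mem_Ico.1 h1
      obtain ⟨h2, h3⟩ := mem_boundedTuples.1 h2
      refine mem_boundedTuples.2 ⟨fun i => ?_, strictAnti_cons.2 ⟨fun i => (h2 i).2, h3⟩⟩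
      induction i using Fin.cases with
      | zero => simpa using h1
      | succ i =>
        have := h2 i
        simp only [Fin.cons_succ] at *
        omega
    · intro n _
      exact Fin.cons_self_tail n
    · rintro ⟨j, n⟩ _
      simp
    · intro n _
      exact Fin.prod_univ_succ _

theorem Admissible.hasSum_mzvTerm {l : List ℕ} (hl : Admissible l) :
    HasSum (mzvTerm l) (∑' n, mzvSeq l n) := by
  let S : ℕ → Finset (DecreasingTuple l.length) := fun N =>
    (boundedTuples l.length (N + 1)).subtype fun n => StrictAnti n ∧ ∀ i, 1 ≤ n i
  have memS : ∀ N (x : DecreasingTuple l.length), x ∈ S N ↔ ∀ i, x.1 i < N + 1 := by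
    intro N x
    refine Finset.mem_subtype.trans (mem_boundedTuples.trans ?_)
    exact ⟨fun h i => (h.1 i).2, fun h => ⟨fun i => ⟨x.2.2 i, h i⟩, x.2.1⟩⟩
  have sumS : ∀ N, ∑ x ∈ S N, mzvTerm l x = partialSum (mzvSeq l) (N + 1) := by
    intro N
    rw [← sum_boundedTuples hl.1 (by omega)]
    refine Finset.sum_bij (fun x _ => x.1) ?_ ?_ ?_ ?_
    · intro x hx
      exact Finset.mem_subtype.1 hx
    · intro x _ y _ h
      exact Subtype.ext h
    · intro n hn
      obtain ⟨h1, h2⟩ := mem_boundedTuples.1 hn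
      exact ⟨⟨n, h2, fun i => (h1 i).1⟩, Finset.mem_subtype.2 hn, rfl⟩
    · intro x _
      simp [mzvTerm]
  have htop : Filter.Tendsto S Filter.atTop Filter.atTop := by
    refine Filter.tendsto_atTop_finset_of_monotone (fun a b hab x hx => ?_) fun x => ?_
    · exact (memS b x).2 fun i => ((memS a x).1 hx i).trans_le (by omega)
    -- The sum of the entries bounds each entry, so every tuple eventually lies in `S N`.
    · exact ⟨∑ i, x.1 i, (memS _ x).2 fun i => Nat.lt_succ_of_le
        (Finset.single_le_sum (f := x.1) (fun _ _ => Nat.zero_le _) (Finset.mem_univ i))⟩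
  have hnonneg : 0 ≤ mzvTerm l := fun x => by
    simp only [mzvTerm, Pi.zero_apply]
    positivity
  have hs := hl.summable_mzvSeq
  have hsummable : Summable (mzvTerm l) := by
    refine summable_of_sum_le (c := ∑' n, mzvSeq l n) hnonneg fun u => ?_
    obtain ⟨N, hN⟩ := (htop.eventually_ge_atTop u).exists
    calc ∑ x ∈ u, mzvTerm l x ≤ ∑ x ∈ S N, mzvTerm l x :=
          Finset.sum_le_sum_of_subset_of_nonneg hN fun x _ _ => hnonneg x
      _ ≤ ∑' n, mzvSeq l n := by
          rw [sumS]
          exact hs.sum_le_tsum _ fun n _ => mzvSeq_nonneg l n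
  have h1 := hsummable.hasSum.comp htop
  have h2 : Filter.Tendsto (fun N => ∑ x ∈ S N, mzvTerm l x) Filter.atTop
      (nhds (∑' n, mzvSeq l n)) := by
    simp only [sumS]
    exact hs.hasSum.tendsto_sum_nat.comp (Filter.tendsto_add_atTop_nat 1)
  rw [← tendsto_nhds_unique h1 h2]
  exact hsummable.hasSum

/-! ### Admissibility and the final comparison. -/

theorem one_le_of_mem_insertOnes {k s : List ℕ} {a : ℕ} (h : a ∈ insertOnes k s) : 1 ≤ a := by
  induction k generalizing s with
  | nil => simp [insertOnes] at h
  | cons b k ih =>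
    cases s with
    | nil => simp [insertOnes] at h
    | cons c s =>
      simp only [insertOnes, List.zipWith_cons_cons, List.flatten_cons, List.mem_append,
        List.mem_cons, List.mem_replicate] at h
      rcases h with (h | h) | h
      · omega
      · omega
      · exact ih h

theorem admissible_insertOnes {k s : List ℕ} (hk : ∀ a ∈ k, 1 ≤ a) (hd : 1 ≤ k.length)
    (hs : s.length = k.length) : Admissible (insertOnes k s) := by
  refine ⟨fun a => one_le_of_mem_insertOnes, ?_⟩
  match k, s, hk, hd, hs with
  | a :: k, b :: s, hk, _, _ =>
    exact ⟨a + 1, _, by rfl, by have := hk a (by simp); omega⟩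

theorem one_le_of_mem_indexAdd {l s : List ℕ} (hl : ∀ a ∈ l, 1 ≤ a) {a : ℕ}
    (h : a ∈ indexAdd l s) : 1 ≤ a := by
  induction l generalizing s with
  | nil => simp [indexAdd] at h
  | cons b l ih =>
    cases s with
    | nil => simp [indexAdd] at h
    | cons c s =>
      simp only [indexAdd, List.zipWith_cons_cons, List.mem_cons] at h
      rcases h with h | h
      · have := hl b (by simp)
        omega
      · exact ih (fun c hc => hl c (by simp [hc])) h

theorem admissible_indexAdd {l s : List ℕ} (hl : ∀ a ∈ l, 1 ≤ a) (hs : ∀ a ∈ s, 1 ≤ a)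
    (hd : 1 ≤ l.length) (hlen : s.length = l.length) : Admissible (indexAdd l s) := by
  refine ⟨fun a => one_le_of_mem_indexAdd hl, ?_⟩
  match l, s, hl, hs, hd, hlen with
  | a :: l, b :: s, hl, hs, _, _ =>
    refine ⟨a + b, _, by rfl, ?_⟩
    have := hl a (by simp)
    have := hs b (by simp)
    omega

theorem mzv_eq_tsum {l : List ℕ} (hl : Admissible l) : mzv l = ∑' n, mzvSeq l n :=
  hl.hasSum_mzvTerm.tsum_eq

theorem posLists_eq_empty {p r : ℕ} (h : r < p) : posLists p r = ∅ := by
  refine Finset.eq_empty_of_forall_notMem fun s hs => ?_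
  obtain ⟨h1, h2, h3⟩ := mem_posLists.1 hs
  have := List.length_le_sum_of_one_le s h3
  omega

/-- Both sides are limits of the same coefficient, computed once with the kernel and once as
truncated multiple zeta sums. -/
theorem sum_mzv_insertOnes {k : List ℕ} (hk : ∀ a ∈ k, 1 ≤ a) (hd : 1 ≤ k.length) (r : ℕ) :
    ∑ s ∈ posLists k.length r, mzv (insertOnes k s) =
      ∑ l ∈ refinements k, ∑ s ∈ posLists l.length r,
        (-1) ^ (l.length + k.length) * mzv (indexAdd l s) := by
  have adm : ∀ i, ∀ s ∈ posLists k.length i, Admissible (insertOnes k s) := fun i s hs =>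
    admissible_insertOnes hk hd (mem_posLists.1 hs).1
  have adm' : ∀ l ∈ refinements k, ∀ s ∈ posLists l.length r, Admissible (indexAdd l s) := by
    intro l hl s hs
    obtain ⟨h1, h2⟩ := (mem_refinements hk).1 hl
    obtain ⟨h3, -, h4⟩ := mem_posLists.1 hs
    exact admissible_indexAdd h2 h4 (hd.trans h1.length_le) h3
  have h1 := tendsto_sum_kernel (r := r) adm
  have h2 : Filter.Tendsto (fun M => PowerSeries.coeff r
      (∑ n ∈ Finset.range (M + 1), kernel M n * addSeq k n)) Filter.atTop
      (nhds (∑ l ∈ refinements k, ∑ s ∈ posLists l.length r,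
        (-1) ^ (l.length + k.length) * mzv (indexAdd l s))) := by
    have e : ∀ M, ∑ n ∈ Finset.range (M + 1), kernel M n * addSeq k n =
        partialSum (refineGen k) (M + 1) := fun M => (kernelRelated_refineGen hk M).symm
    simp only [e, coeff_partialSum_refineGen]
    refine tendsto_finsetSum _ fun l hl => tendsto_finsetSum _ fun s hs => ?_
    rw [mzv_eq_tsum (adm' l hl s hs)]
    exact ((adm' l hl s hs).summable_mzvSeq.hasSum.tendsto_sum_nat.comp
      (Filter.tendsto_add_atTop_nat 1)).const_mul _
  rw [← tendsto_nhds_unique h1 h2]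
  exact Finset.sum_congr rfl fun s hs => mzv_eq_tsum (adm r s hs)

open Classical in
theorem theorem2 (k : List ℕ) (hk : ∀ a ∈ k, 1 ≤ a) (hd : 1 ≤ k.length)
    (r : ℕ) (hr : k.length ≤ r) :
    (∀ s : Composition r, s.length = k.length → MZVConverges (insertOnes k s.blocks)) ∧
    (∀ k' : Composition k.sum, Refines k'.blocks k → k'.length ≤ r →
      ∀ s : Composition r, s.length = k'.length →
        MZVConverges (indexAdd k'.blocks s.blocks)) ∧
    ∑ s : Composition r with s.length = k.length, mzv (insertOnes k s.blocks) =
      ∑ k' : Composition k.sum with Refines k'.blocks k ∧ k'.length ≤ r,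
        ∑ s : Composition r with s.length = k'.length,
          (-1 : ℝ) ^ ((k'.length : ℤ) - (k.length : ℤ)) *
            mzv (indexAdd k'.blocks s.blocks) := by
  refine ⟨fun s hs => ?_, fun k' h1 h2 s hs => ?_, ?_⟩
  · exact (admissible_insertOnes hk hd hs).hasSum_mzvTerm.summable
  · exact (admissible_indexAdd (fun a ha => k'.blocks_pos ha) (fun a ha => s.blocks_pos ha)
      (hd.trans h1.length_le) hs).hasSum_mzvTerm.summable
  · have sign : ∀ a b : ℕ, (-1 : ℝ) ^ ((a : ℤ) - (b : ℤ)) = (-1) ^ (a + b) := by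
      intro a b
      rw [zpow_sub₀ (by norm_num), zpow_natCast, zpow_natCast, pow_add, div_eq_mul_inv, ← inv_pow]
      norm_num
    have hL := sum_composition_eq_sum_posLists k.length r fun s => mzv (insertOnes k s)
    have hR := sum_composition_eq_sum_refinements hk (fun p => p ≤ r) fun l =>
      ∑ s ∈ posLists l.length r, (-1 : ℝ) ^ (l.length + k.length) * mzv (indexAdd l s)
    -- Refinements of depth greater than r contribute an empty sum, so the depth restriction costs
    -- nothing.
    have hF := Finset.sum_filter_of_ne (s := refinements k) (p := fun l => l.length ≤ r)
      (f := fun l => ∑ s ∈ posLists l.length r,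
        (-1 : ℝ) ^ (l.length + k.length) * mzv (indexAdd l s)) fun l _ h => by
          by_contra hlt
          exact h (by rw [posLists_eq_empty (not_le.1 hlt), Finset.sum_empty])
    rw [hL, sum_mzv_insertOnes hk hd r, ← hF, ← hR]
    refine Finset.sum_congr rfl fun k' _ => ?_
    rw [← sum_composition_eq_sum_posLists]
    exact Finset.sum_congr rfl fun s _ => by rw [sign]
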